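/- Let $0<\alpha<1$ and let $a=(a_0,a_1,a_2,\ldots)$ be the sequence $a_n=\frac{(n+1)^{\alpha}-n^{\alpha}}{\Gamma(1+\alpha)}$, $n\ge 0$. Let $a^{(-1)}$ be its inverse for the convolution $(u*v)_n=\sum_{m=0}^n u_m v_{n-m}$ of real sequences, i.e. the sequence with $a*a^{(-1)}=(1,0,0,\ldots)$. Put $c_0=a^{(-1)}_0$, $c_i=-a^{(-1)}_i$ for $i\ge 1$, and $c_n^n=c_0-\sum_{i=1}^{n-1}c_i$ for $n\ge 1$; these are the coefficients of the discretization $$(\mathcal{D}^{\alpha}X)_n=k^{-\alpha}\bigl(a^{(-1)}*(X-X_0)\bigr)_n=k^{-\alpha}\Bigl(c_0X_n-\sum_{i=1}^{n-1}c_iX_{n-i}-c_n^nX_0\Bigr),\qquad n\ge 1,$$ of the Caputo derivative of order $\alpha$ with time step $k>0$. Then the following hold. (1) $c_i>0$ for all $i\ge 0$, the series $\sum_{i\ge1}c_i$ converges, and $c_0=\sum_{i=1}^{\infty}c_i=\Gamma(1+\alpha)$. Consequently, for every $n\ge 1$, $c_n^n=\sum_{i=n}^{\infty}c_i>0$ and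 $c_0=\sum_{i=1}^{n-1}c_i+c_n^n$. (2) As $j\to\infty$ and $n\to\infty$ respectively, $$c_j=\frac{-1}{\Gamma(-\alpha)}\,j^{-1-\alpha}\,(1+o(1)),\qquad c_n^n=\frac{n^{-\alpha}}{\Gamma(1-\alpha)}\,(1+o(1)).$$ -/

import Mathlib

namespace CaputoDeconv

/-- Discrete convolution of real sequences, `(u * v)_n = ∑_{m=0}^n u_m v_{n-m}`. -/
def conv (u v : ℕ → ℝ) (n : ℕ) : ℝ :=
  ∑ m ∈ Finset.range (n + 1), u m * v (n - m)

/-- The unit `(1, 0, 0, …)` of the discrete convolution. -/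
def delta (n : ℕ) : ℝ := if n = 0 then 1 else 0

/-- The convolution inverse of `u`, namely the coefficient sequence of the inverse of the formal
power series `∑ u_n z^n`; it is characterized by `conv_eq_delta_iff` whenever `u 0 ≠ 0`. -/
noncomputable def convInv (u : ℕ → ℝ) (n : ℕ) : ℝ :=
  PowerSeries.coeff n (PowerSeries.mk u)⁻¹

/-- The weights `a_n = ((n + 1)^α - n^α) / Γ(1 + α)` of the discretized Volterra integral. -/
noncomputable def a (α : ℝ) (n : ℕ) : ℝ :=
  (((n : ℝ) + 1) ^ α - (n : ℝ) ^ α) / Real.Gamma (1 + α)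

/-- The coefficients of the deconvolved scheme: `c_0 = a^{(-1)}_0` and `c_i = -a^{(-1)}_i` for
`i ≥ 1`. -/
noncomputable def c (α : ℝ) (i : ℕ) : ℝ :=
  if i = 0 then convInv (a α) 0 else -convInv (a α) i

/-- The coefficient `c_n^n = c_0 - ∑_{i=1}^{n-1} c_i` of the initial value, for `n ≥ 1`. -/
noncomputable def cInit (α : ℝ) (n : ℕ) : ℝ :=
  c α 0 - ∑ i ∈ Finset.Ico 1 n, c α i

theorem mk_conv (u v : ℕ → ℝ) :
    PowerSeries.mk (conv u v) = PowerSeries.mk u * PowerSeries.mk v := by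
  ext n
  simp [PowerSeries.coeff_mul, conv, Finset.Nat.sum_antidiagonal_eq_sum_range_succ_mk]

theorem mk_delta : PowerSeries.mk delta = 1 := by
  ext n
  simp [PowerSeries.coeff_one, delta]

/-- `convInv u` is the one and only convolution inverse of `u` as soon as `u 0 ≠ 0`. -/
theorem conv_eq_delta_iff (u v : ℕ → ℝ) (hu : u 0 ≠ 0) :
    conv u v = delta ↔ v = convInv u := by
  have h0 : PowerSeries.constantCoeff (PowerSeries.mk u) ≠ 0 := by
    rw [← PowerSeries.coeff_zero_eq_constantCoeff_apply, PowerSeries.coeff_mk]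
    exact hu
  have hinv : PowerSeries.mk (convInv u) = (PowerSeries.mk u)⁻¹ := by
    ext n
    simp [convInv]
  have hinj : ∀ f g : ℕ → ℝ, PowerSeries.mk f = PowerSeries.mk g → f = g := by
    intro f g h
    funext n
    simpa using congrArg (PowerSeries.coeff n) h
  constructor
  · intro h
    apply hinj
    rw [hinv, PowerSeries.eq_inv_iff_mul_eq_one h0, mul_comm, ← mk_conv, h, mk_delta]
  · rintro rfl
    apply hinj
    rw [mk_conv, hinv, mk_delta, PowerSeries.mul_inv_cancel _ h0]

/-- The sequence `a` starts with `1 / Γ(1 + α) ≠ 0`, so it has a convolution inverse. -/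
theorem a_zero_ne_zero (α : ℝ) (hα : 0 < α) : a α 0 ≠ 0 := by
  have hG : Real.Gamma (1 + α) ≠ 0 := (Real.Gamma_pos_of_pos (by linarith)).ne'
  simp [a, Real.zero_rpow hα.ne', hG]

end CaputoDeconv

namespace CaputoDeconv

open Finset Filter Topology Polynomial

/-! The weights are Hausdorff moments: `a α n` is a positive multiple of the integral over `s` in
(0,1) of (n+s)^(α-1), itself a mixture of the powers (e^(-x))^n. If b is the convolution inverse of
a moment sequence with functional L, the polynomials P_n = `shiftPoly b n` satisfy L(P_n) = 0 for n
≥ 1 and L(P_j P_k) = -b_(j+k) for j, k ≥ 1. Testing L on squares times X or 1-X shows that -b_n is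
nonnegative and decreasing from n = 2 on.

For the asymptotics, the numbers d_n = `cInit α (n + 1)` have generating function B(z)/(1-z), with B
that of the inverse. As `a` is asymptotic to the coefficients of (1-z)^(-α), regular averaging gives
d_0 + ... + d_n ~ n^(1-α)/Γ(2-α). The monotone density theorem, applied to these sums and then to
-`cInit`, yields both equivalents. Strict positivity and the sum of the series follow from them. -/

/-! ### Hausdorff moment sequences -/

/-- The linear functional on polynomials whose moments are `u`. -/
noncomputable def momentFunctional (u : ℕ → ℝ) : ℝ[X] →ₗ[ℝ] ℝ :=
  Polynomial.lsum fun n => u n • LinearMap.id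

theorem momentFunctional_C_mul_X_pow (u : ℕ → ℝ) (r : ℝ) (n : ℕ) :
    momentFunctional u (C r * X ^ n) = r * u n := by
  rw [C_mul_X_pow_eq_monomial]
  simp [momentFunctional, Polynomial.lsum_apply, Polynomial.sum_monomial_index, mul_comm]

theorem momentFunctional_C (u : ℕ → ℝ) (r : ℝ) : momentFunctional u (C r) = r * u 0 := by
  simpa using momentFunctional_C_mul_X_pow u r 0

theorem momentFunctional_X_pow (u : ℕ → ℝ) (n : ℕ) : momentFunctional u (X ^ n) = u n := by
  simpa using momentFunctional_C_mul_X_pow u 1 n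

theorem momentFunctional_C_mul (u : ℕ → ℝ) (r : ℝ) (p : ℝ[X]) :
    momentFunctional u (C r * p) = r * momentFunctional u p := by
  rw [← Polynomial.smul_eq_C_mul, map_smul, smul_eq_mul]

/-- A sequence is a Hausdorff moment sequence when its moment functional is nonnegative on the
polynomials that are nonnegative on `[0, 1]`. -/
def IsHausdorffMoment (u : ℕ → ℝ) : Prop :=
  ∀ p : ℝ[X], (∀ t : ℝ, 0 ≤ t → t ≤ 1 → 0 ≤ p.eval t) → 0 ≤ momentFunctional u p

theorem IsHausdorffMoment.nonneg {u : ℕ → ℝ} (hu : IsHausdorffMoment u) (n : ℕ) : 0 ≤ u n := by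
  rw [← momentFunctional_X_pow u n]
  exact hu _ fun t ht _ => by simpa using pow_nonneg ht n

theorem IsHausdorffMoment.antitone {u : ℕ → ℝ} (hu : IsHausdorffMoment u) : Antitone u := by
  refine antitone_nat_of_succ_le fun n => ?_
  have h := hu (X ^ n - X ^ (n + 1)) fun t ht ht1 => by
    simpa using pow_le_pow_of_le_one ht ht1 (Nat.le_succ n)
  rw [map_sub, momentFunctional_X_pow, momentFunctional_X_pow] at h
  linarith

/-! ### Convolution inverse of a Hausdorff moment sequence -/

/-- The polynomials `∑_{m ≤ n} b_m X^{n-m}`. -/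
noncomputable def shiftPoly (b : ℕ → ℝ) : ℕ → ℝ[X]
  | 0 => C (b 0)
  | n + 1 => X * shiftPoly b n + C (b (n + 1))

theorem shiftPoly_eq_sum (b : ℕ → ℝ) (n : ℕ) :
    shiftPoly b n = ∑ m ∈ range (n + 1), C (b m) * X ^ (n - m) := by
  induction n with
  | zero => simp [shiftPoly]
  | succ n ih =>
    rw [shiftPoly, ih, sum_range_succ _ (n + 1), mul_sum]
    congr 1
    · refine sum_congr rfl fun m hm => ?_
      rw [Nat.succ_sub (Nat.lt_succ_iff.1 (mem_range.1 hm)), pow_succ]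
      ring
    · simp

/-- `shiftPoly b n` is the coefficient of z^n in B(z)/(1-Xz), and the functional sends 1/(1-Xz) to
the generating function of `u`. -/
theorem momentFunctional_shiftPoly {u b : ℕ → ℝ} (h : conv b u = delta) (n : ℕ) :
    momentFunctional u (shiftPoly b n) = delta n := by
  rw [shiftPoly_eq_sum, map_sum, ← h, conv]
  exact sum_congr rfl fun m _ => momentFunctional_C_mul_X_pow u _ _

theorem momentFunctional_shiftPoly_succ {u b : ℕ → ℝ} (h : conv b u = delta) (n : ℕ) :
    momentFunctional u (shiftPoly b (n + 1)) = 0 := by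
  rw [momentFunctional_shiftPoly h]
  simp [delta]

theorem momentFunctional_X_mul_shiftPoly {u b : ℕ → ℝ} (h : conv b u = delta) (n : ℕ) :
    momentFunctional u (X * shiftPoly b n) = -(b (n + 1) * u 0) := by
  have h1 := momentFunctional_shiftPoly_succ h n
  rw [shiftPoly, map_add, momentFunctional_C] at h1
  linarith

/-- Both products equal the same multiple of X up to constants times polynomials annihilated by the
functional. -/
theorem momentFunctional_shiftPoly_mul_comm {u b : ℕ → ℝ} (h : conv b u = delta) (j k : ℕ) :
    momentFunctional u (shiftPoly b (j + 2) * shiftPoly b (k + 1)) =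
      momentFunctional u (shiftPoly b (j + 1) * shiftPoly b (k + 2)) := by
  have e1 : shiftPoly b (j + 2) * shiftPoly b (k + 1) =
      X * shiftPoly b (j + 1) * shiftPoly b (k + 1) + C (b (j + 2)) * shiftPoly b (k + 1) := by
    rw [shiftPoly]; ring
  have e2 : shiftPoly b (j + 1) * shiftPoly b (k + 2) =
      X * shiftPoly b (j + 1) * shiftPoly b (k + 1) + C (b (k + 2)) * shiftPoly b (j + 1) := by
    rw [shiftPoly.eq_2 b (k + 1)]; ring
  rw [e1, e2, map_add, map_add, momentFunctional_C_mul, momentFunctional_C_mul,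
    momentFunctional_shiftPoly_succ h, momentFunctional_shiftPoly_succ h]
  ring

/-- The entries of the convolution inverse are, up to sign, the moments of a compression of the
multiplication by `X`. -/
theorem momentFunctional_shiftPoly_mul {u b : ℕ → ℝ} (h : conv b u = delta) (j k : ℕ) :
    momentFunctional u (shiftPoly b (j + 1) * shiftPoly b (k + 1)) = -b (j + k + 2) := by
  induction j generalizing k with
  | zero =>
    have h0 : b 0 * u 0 = 1 := by simpa [conv, delta] using congrFun h 0
    have e : shiftPoly b (0 + 1) * shiftPoly b (k + 1) =
        C (b 0) * (X * shiftPoly b (k + 1)) + C (b 1) * shiftPoly b (k + 1) := by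
      rw [shiftPoly, shiftPoly]; ring
    -- Only the term with X survives; its factor b_0 u_0 is 1.
    rw [e, map_add, momentFunctional_C_mul, momentFunctional_C_mul,
      momentFunctional_shiftPoly_succ h, momentFunctional_X_mul_shiftPoly h, zero_add]
    linear_combination (-b (k + 1 + 1)) * h0
  | succ j ih =>
    rw [momentFunctional_shiftPoly_mul_comm h, ih]
    congr 2
    ring

theorem momentFunctional_X_mul_shiftPoly_sq {u b : ℕ → ℝ} (h : conv b u = delta) (k : ℕ) :
    momentFunctional u (X * shiftPoly b (k + 1) ^ 2) = -b (2 * k + 3) := by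
  have e : X * shiftPoly b (k + 1) ^ 2 =
      shiftPoly b (k + 1 + 1) * shiftPoly b (k + 1) - C (b (k + 2)) * shiftPoly b (k + 1) := by
    rw [shiftPoly.eq_2 b (k + 1)]; ring
  rw [e, map_sub, momentFunctional_C_mul, momentFunctional_shiftPoly_succ h,
    momentFunctional_shiftPoly_mul h, mul_zero, sub_zero]
  congr 2
  ring

theorem momentFunctional_X_sq_mul_shiftPoly_sq {u b : ℕ → ℝ} (h : conv b u = delta) (k : ℕ) :
    momentFunctional u (X ^ 2 * shiftPoly b (k + 1) ^ 2) =
      -b (2 * k + 4) + b (k + 2) ^ 2 * u 0 := by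
  have e : X ^ 2 * shiftPoly b (k + 1) ^ 2 =
      shiftPoly b (k + 1 + 1) * shiftPoly b (k + 1 + 1)
        - C (2 * b (k + 2)) * shiftPoly b (k + 1 + 1) + C (b (k + 2) ^ 2) := by
    rw [shiftPoly.eq_2 b (k + 1)]; simp only [C_mul, C_pow, C_ofNat]; ring
  rw [e, map_add, map_sub, momentFunctional_C_mul, momentFunctional_shiftPoly_succ h,
    momentFunctional_shiftPoly_mul h, mul_zero, sub_zero, momentFunctional_C]
  congr 3
  ring

/-- P² detects the entries of even index and X P² those of odd index. -/
theorem IsHausdorffMoment.convInverse_nonpos {u b : ℕ → ℝ} (hu : IsHausdorffMoment u)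
    (h : conv b u = delta) (n : ℕ) : b (n + 2) ≤ 0 := by
  obtain ⟨k, rfl | rfl⟩ := Nat.even_or_odd' n
  · have := hu (shiftPoly b (k + 1) * shiftPoly b (k + 1)) fun t _ _ => by
      rw [eval_mul]; exact mul_self_nonneg _
    rw [momentFunctional_shiftPoly_mul h, ← two_mul] at this
    linarith
  · have := hu (X * shiftPoly b (k + 1) ^ 2) fun t ht _ => by
      rw [eval_mul, eval_pow, eval_X]; exact mul_nonneg ht (sq_nonneg _)
    rw [momentFunctional_X_mul_shiftPoly_sq h] at this
    linarith

/-- The test polynomials are (1-X)P² and X(1-X)P², according to parity. -/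
theorem IsHausdorffMoment.convInverse_le_succ {u b : ℕ → ℝ} (hu : IsHausdorffMoment u)
    (h : conv b u = delta) (n : ℕ) : b (n + 2) ≤ b (n + 3) := by
  obtain ⟨k, rfl | rfl⟩ := Nat.even_or_odd' n
  · have := hu (shiftPoly b (k + 1) * shiftPoly b (k + 1) - X * shiftPoly b (k + 1) ^ 2)
      fun t _ ht => by
        rw [eval_sub, eval_mul, eval_mul, eval_pow, eval_X]
        nlinarith [mul_nonneg (sub_nonneg.2 ht) (sq_nonneg (eval t (shiftPoly b (k + 1))))]
    rw [map_sub, momentFunctional_shiftPoly_mul h, momentFunctional_X_mul_shiftPoly_sq h,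
      ← two_mul] at this
    linarith
  · have := hu (X * shiftPoly b (k + 1) ^ 2 - X ^ 2 * shiftPoly b (k + 1) ^ 2)
      fun t ht0 ht => by
        rw [eval_sub, eval_mul, eval_mul, eval_pow, eval_pow, eval_X]
        nlinarith [mul_nonneg (mul_nonneg ht0 (sub_nonneg.2 ht))
          (sq_nonneg (eval t (shiftPoly b (k + 1))))]
    rw [map_sub, momentFunctional_X_mul_shiftPoly_sq h,
      momentFunctional_X_sq_mul_shiftPoly_sq h] at this
    -- The extra term b_(k+2)² u_0 has the favourable sign.
    have h0 := mul_nonneg (sq_nonneg (b (k + 2))) (hu.nonneg 0)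
    rw [show 2 * k + 1 + 2 = 2 * k + 3 by ring, show 2 * k + 1 + 3 = 2 * k + 4 by ring]
    linarith

/-! ### The weights as Hausdorff moments -/

theorem integrableOn_rpow_neg_mul_exp {α r : ℝ} (hα : α < 1) (hr : 0 < r) :
    MeasureTheory.IntegrableOn (fun x : ℝ => x ^ (-α) * Real.exp (-(r * x))) (Set.Ioi 0) := by
  have := integrableOn_rpow_mul_exp_neg_mul_rpow (p := 1) (s := -α) (by linarith) one_pos hr
  simpa using this

theorem integral_rpow_neg_mul_exp {α r : ℝ} (hα : α < 1) (hr : 0 < r) :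
    ∫ x in Set.Ioi (0 : ℝ), x ^ (-α) * Real.exp (-(r * x)) =
      r ^ (α - 1) * Real.Gamma (1 - α) := by
  have := Real.integral_rpow_mul_exp_neg_mul_Ioi (a := 1 - α) (by linarith) hr
  rw [show 1 - α - 1 = -α by ring] at this
  rw [this, one_div, Real.inv_rpow hr.le, ← Real.rpow_neg hr.le]
  congr 2
  ring

/-- The shifted powers `(n + s)^(α - 1)` are Hausdorff moments. -/
theorem isHausdorffMoment_add_rpow {α s : ℝ} (hα : α < 1) (hs : 0 < s) :
    IsHausdorffMoment fun n => ((n : ℝ) + s) ^ (α - 1) := by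
  intro p hp
  have hG : 0 < Real.Gamma (1 - α) := Real.Gamma_pos_of_pos (by linarith)
  -- Gamma integral for (n+s)^(α-1): the moment variable is t = e^(-x), which lies in (0,1).
  have key : momentFunctional (fun n => ((n : ℝ) + s) ^ (α - 1)) p * Real.Gamma (1 - α) =
      ∫ x in Set.Ioi (0 : ℝ), x ^ (-α) * Real.exp (-(s * x)) * p.eval (Real.exp (-x)) := by
    have hpos : ∀ n : ℕ, 0 < (n : ℝ) + s := fun n => by positivity
    have e : ∀ x : ℝ, x ^ (-α) * Real.exp (-(s * x)) * p.eval (Real.exp (-x)) =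
        ∑ n ∈ range (p.natDegree + 1),
          p.coeff n * (x ^ (-α) * Real.exp (-(((n : ℝ) + s) * x))) := by
      intro x
      rw [eval_eq_sum_range, mul_sum]
      refine sum_congr rfl fun n _ => ?_
      rw [← Real.exp_nat_mul, show -(((n : ℝ) + s) * x) = -(s * x) + n * -x by ring, Real.exp_add]
      ring
    simp_rw [e]
    rw [MeasureTheory.integral_finsetSum _ fun n _ =>
      (integrableOn_rpow_neg_mul_exp hα (hpos n)).const_mul _]
    simp_rw [MeasureTheory.integral_const_mul, integral_rpow_neg_mul_exp hα (hpos _)]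
    conv_lhs => rw [p.as_sum_range_C_mul_X_pow, map_sum, sum_mul]
    simp_rw [momentFunctional_C_mul_X_pow, mul_assoc]
  refine nonneg_of_mul_nonneg_left ?_ hG
  rw [key]
  refine MeasureTheory.setIntegral_nonneg measurableSet_Ioi fun x hx => ?_
  have hx : 0 < x := hx
  exact mul_nonneg (by positivity)
    (hp _ (Real.exp_pos _).le (Real.exp_le_one_iff.2 (by linarith)))

theorem intervalIntegrable_add_rpow {α : ℝ} (hα : 0 < α) (n : ℕ) :
    IntervalIntegrable (fun s => ((n : ℝ) + s) ^ (α - 1)) MeasureTheory.volume 0 1 := by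
  have := (intervalIntegral.intervalIntegrable_rpow' (a := (n : ℝ)) (b := n + 1)
    (r := α - 1) (by linarith)).comp_add_left n
  simpa using this

theorem a_eq_integral {α : ℝ} (hα : 0 < α) (n : ℕ) :
    a α n = α / Real.Gamma (1 + α) * ∫ s in (0 : ℝ)..1, ((n : ℝ) + s) ^ (α - 1) := by
  rw [intervalIntegral.integral_comp_add_left (fun x => x ^ (α - 1)),
    integral_rpow (Or.inl (by linarith)), a]
  simp
  field_simp

theorem isHausdorffMoment_a {α : ℝ} (hα0 : 0 < α) (hα1 : α < 1) : IsHausdorffMoment (a α) := by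
  intro p hp
  have key : momentFunctional (a α) p = α / Real.Gamma (1 + α) *
      ∫ s in (0 : ℝ)..1, momentFunctional (fun n => ((n : ℝ) + s) ^ (α - 1)) p := by
    have e : ∀ u : ℕ → ℝ, momentFunctional u p =
        ∑ n ∈ range (p.natDegree + 1), p.coeff n * u n := by
      intro u
      conv_lhs => rw [p.as_sum_range_C_mul_X_pow, map_sum]
      simp_rw [momentFunctional_C_mul_X_pow]
    simp_rw [e]
    rw [intervalIntegral.integral_finsetSum fun n _ =>
      (intervalIntegrable_add_rpow hα0 n).const_mul _, mul_sum]
    refine sum_congr rfl fun n _ => ?_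
    rw [intervalIntegral.integral_const_mul, a_eq_integral hα0]
    ring
  rw [key]
  have hG : 0 < Real.Gamma (1 + α) := Real.Gamma_pos_of_pos (by linarith)
  refine mul_nonneg (by positivity) ?_
  rw [intervalIntegral.integral_of_le zero_le_one]
  exact MeasureTheory.setIntegral_nonneg measurableSet_Ioc fun s hs =>
    isHausdorffMoment_add_rpow hα1 hs.1 p hp

theorem a_pos {α : ℝ} (hα0 : 0 < α) (n : ℕ) : 0 < a α n := by
  refine div_pos (sub_pos.2 ?_) (Real.Gamma_pos_of_pos (by linarith))
  exact Real.rpow_lt_rpow n.cast_nonneg (by linarith) hα0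

/-! ### Regular averages and the coefficients of (1-z)^(-β) -/

/-- Regular averages with nonnegative weights preserve limits (Silverman–Toeplitz). -/
theorem tendsto_sum_mul_of_regular {w : ℕ → ℕ → ℝ} {x : ℕ → ℝ} {l : ℝ}
    (hw : ∀ n m, 0 ≤ w n m) (hsum : ∀ n, ∑ m ∈ range (n + 1), w n m = 1)
    (hlim : ∀ m, Tendsto (fun n => w n m) atTop (𝓝 0)) (hx : Tendsto x atTop (𝓝 l)) :
    Tendsto (fun n => ∑ m ∈ range (n + 1), w n m * x m) atTop (𝓝 l) := by
  rw [Metric.tendsto_atTop]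
  intro ε hε
  obtain ⟨N, hN⟩ := Metric.tendsto_atTop.1 hx (ε / 2) (half_pos hε)
  -- Head: finitely many columns, each tending to zero. The tail is at most ε/2 times the total
  -- weight 1.
  have hfin : Tendsto (fun n => ∑ m ∈ range N, w n m * |x m - l|) atTop (𝓝 0) := by
    simpa using tendsto_finsetSum (range N) fun m _ => (hlim m).mul_const |x m - l|
  obtain ⟨M, hM⟩ := eventually_atTop.1 (hfin.eventually_lt_const (half_pos hε))
  refine ⟨max M N, fun n hn => ?_⟩
  have hNn : N ≤ n + 1 := (le_max_right M N).trans (hn.trans (Nat.le_succ n))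
  have e : ∑ m ∈ range (n + 1), w n m * x m - l =
      ∑ m ∈ range (n + 1), w n m * (x m - l) := by
    simp_rw [mul_sub, sum_sub_distrib, ← sum_mul, hsum, one_mul]
  rw [Real.dist_eq, e]
  calc |∑ m ∈ range (n + 1), w n m * (x m - l)|
      ≤ ∑ m ∈ range (n + 1), w n m * |x m - l| := by
        refine (abs_sum_le_sum_abs _ _).trans_eq (sum_congr rfl fun m _ => ?_)
        rw [abs_mul, abs_of_nonneg (hw n m)]
    _ = ∑ m ∈ range N, w n m * |x m - l| + ∑ m ∈ Ico N (n + 1), w n m * |x m - l| :=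
        (sum_range_add_sum_Ico _ hNn).symm
    _ ≤ ∑ m ∈ range N, w n m * |x m - l| + ∑ m ∈ Ico N (n + 1), w n m * (ε / 2) := by
        gcongr with m hm
        · exact hw n m
        · exact (hN m (mem_Ico.1 hm).1).le
    _ ≤ ∑ m ∈ range N, w n m * |x m - l| + ∑ m ∈ range (n + 1), w n m * (ε / 2) := by
        refine add_le_add_right (sum_le_sum_of_subset_of_nonneg
          (fun m hm => mem_range.2 (mem_Ico.1 hm).2)
          fun m _ _ => mul_nonneg (hw n m) (half_pos hε).le) _
    _ < ε / 2 + ε / 2 := by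
        rw [← sum_mul, hsum, one_mul]
        gcongr
        exact hM n ((le_max_left M N).trans hn)
    _ = ε := add_halves ε

/-- The coefficients of the power series of `(1 - z)^(-β)`. -/
noncomputable def negBinom (β : ℝ) (n : ℕ) : ℝ := Ring.multichoose β n

theorem negBinom_eq_prod (β : ℝ) (n : ℕ) :
    negBinom β n = (∏ j ∈ range n, (β + j)) / n.factorial := by
  have h := Ring.factorial_nsmul_multichoose_eq_ascPochhammer β n
  rw [nsmul_eq_mul, Polynomial.ascPochhammer_smeval_eq_eval] at h
  have h2 : ∀ n : ℕ, (ascPochhammer ℝ n).eval β = ∏ j ∈ range n, (β + j) := by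
    intro n
    induction n with
    | zero => simp
    | succ n ih => rw [ascPochhammer_succ_eval, ih, prod_range_succ]
  rw [h2] at h
  rw [negBinom, eq_div_iff (by positivity), mul_comm, h]

theorem negBinom_pos {β : ℝ} (hβ : 0 < β) (n : ℕ) : 0 < negBinom β n := by
  rw [negBinom_eq_prod]
  exact div_pos (prod_pos fun j _ => by positivity) (by positivity)

theorem negBinom_one (n : ℕ) : negBinom 1 n = 1 := by
  simp [negBinom]

/-- Chu–Vandermonde at -β and -γ, with the signs (-1)^n cancelled. -/
theorem conv_negBinom (β γ : ℝ) : conv (negBinom β) (negBinom γ) = negBinom (β + γ) := by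
  funext n
  have h := Ring.add_choose_eq n (Commute.all (-β) (-γ))
  rw [← neg_add, Finset.Nat.sum_antidiagonal_eq_sum_range_succ
    (fun i j => Ring.choose (-β) i * Ring.choose (-γ) j)] at h
  have hc : ∀ (r : ℝ) (k : ℕ), Ring.choose (-r) k = (-1) ^ k * negBinom r k := by
    intro r k
    rw [Ring.choose_neg', negBinom]
    simp [Units.smul_def]
  simp_rw [hc] at h
  have hs : ((-1 : ℝ) ^ n) ≠ 0 := by simp
  apply mul_left_cancel₀ hs
  rw [h, conv, mul_sum]
  refine sum_congr rfl fun m hm => ?_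
  have hm : m ≤ n := Nat.lt_succ_iff.1 (mem_range.1 hm)
  conv_lhs => rw [← Nat.add_sub_cancel' hm, pow_add, Nat.add_sub_cancel_left]
  ring

theorem tendsto_negBinom_div_rpow {β : ℝ} (hβ : 0 < β) :
    Tendsto (fun n : ℕ => negBinom β n / (n : ℝ) ^ (β - 1)) atTop (𝓝 (1 / Real.Gamma β)) := by
  have h1 := (Real.GammaSeq_tendsto_Gamma β).inv₀ (Real.Gamma_pos_of_pos hβ).ne'
  -- Euler's product has one more factor, β + n, than `negBinom β n`.
  have h2 : Tendsto (fun n : ℕ => ((n : ℝ) / (β + n))) atTop (𝓝 1) :=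
    by simpa [add_comm] using tendsto_natCast_div_add_atTop β
  have h := h2.mul h1
  rw [one_mul, ← one_div] at h
  refine h.congr' ?_
  filter_upwards [eventually_gt_atTop 0] with n hn
  have hn' : (0 : ℝ) < n := by exact_mod_cast hn
  rw [Real.GammaSeq, negBinom_eq_prod, prod_range_succ, Real.rpow_sub_one hn'.ne']
  have : (0 : ℝ) < ∏ j ∈ range n, (β + j) := prod_pos fun j _ => by positivity
  have : (0 : ℝ) < β + n := by positivity
  have := Real.rpow_pos_of_pos hn' β
  have : (0 : ℝ) < n.factorial := by positivity
  field_simp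

/-- After factoring out n^α, this is the derivative of x^α at 1 along the steps 1/n. -/
theorem tendsto_a_div_rpow {α : ℝ} (hα : 0 < α) :
    Tendsto (fun n : ℕ => a α n / (n : ℝ) ^ (α - 1)) atTop (𝓝 (1 / Real.Gamma α)) := by
  have hd : HasDerivAt (fun x : ℝ => x ^ α) (α * 1 ^ (α - 1)) 1 :=
    Real.hasDerivAt_rpow_const (Or.inl one_ne_zero)
  have hs := hasDerivAt_iff_tendsto_slope_zero.1 hd
  have hinv : Tendsto (fun n : ℕ => ((n : ℝ))⁻¹) atTop (𝓝[≠] 0) :=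
    tendsto_nhdsWithin_iff.2 ⟨tendsto_inv_atTop_nhds_zero_nat, by
      filter_upwards [eventually_gt_atTop 0] with n hn
      simpa using hn.ne'⟩
  have h := (hs.comp hinv).div_const (Real.Gamma (1 + α))
  rw [Real.one_rpow (α - 1), mul_one, add_comm 1 α, Real.Gamma_add_one hα.ne',
    div_mul_cancel_left₀ hα.ne', ← one_div] at h
  refine h.congr' ?_
  filter_upwards [eventually_gt_atTop 0] with n hn
  have hn' : (0 : ℝ) < n := by exact_mod_cast hn
  have e : ((n : ℝ) + 1) ^ α = (n : ℝ) ^ α * (1 + (n : ℝ)⁻¹) ^ α := by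
    rw [← Real.mul_rpow hn'.le (by positivity)]
    congr 1
    field_simp
  have := Real.rpow_pos_of_pos hn' α
  rw [a, e, Real.rpow_sub_one hn'.ne', ← Real.Gamma_add_one hα.ne', add_comm α 1]
  simp only [Function.comp, Real.one_rpow, inv_inv, smul_eq_mul]
  field_simp

theorem tendsto_negBinom_zero {β : ℝ} (hβ : 0 < β) (hβ1 : β < 1) :
    Tendsto (negBinom β) atTop (𝓝 0) := by
  have h := (tendsto_negBinom_div_rpow hβ).mul
    ((tendsto_rpow_neg_atTop (y := 1 - β) (by linarith)).comp tendsto_natCast_atTop_atTop)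
  rw [mul_zero] at h
  refine h.congr' ?_
  filter_upwards [eventually_gt_atTop 0] with n hn
  have hn' : (0 : ℝ) < n := by exact_mod_cast hn
  have := Real.rpow_pos_of_pos hn' (β - 1)
  simp only [Function.comp, neg_sub]
  field_simp

theorem tendsto_negBinom_atTop {β : ℝ} (hβ : 1 < β) : Tendsto (negBinom β) atTop atTop := by
  have hβ0 : 0 < β := by linarith
  have h := (tendsto_negBinom_div_rpow hβ0).pos_mul_atTop
    (one_div_pos.2 (Real.Gamma_pos_of_pos hβ0))
    ((tendsto_rpow_atTop (y := β - 1) (by linarith)).comp tendsto_natCast_atTop_atTop)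
  refine h.congr' ?_
  filter_upwards [eventually_gt_atTop 0] with n hn
  have hn' : (0 : ℝ) < n := by exact_mod_cast hn
  have := Real.rpow_pos_of_pos hn' (β - 1)
  simp only [Function.comp]
  field_simp

/-! ### Comparison of `a` with the binomial coefficients -/

theorem conv_comm (u v : ℕ → ℝ) : conv u v = conv v u := by
  funext n
  rw [conv, conv, ← sum_range_reflect]
  refine sum_congr rfl fun m hm => ?_
  have hm : m ≤ n := Nat.lt_succ_iff.1 (mem_range.1 hm)
  rw [Nat.add_sub_cancel, Nat.sub_sub_self hm, mul_comm]

theorem conv_assoc (u v w : ℕ → ℝ) : conv (conv u v) w = conv u (conv v w) := by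
  have h : PowerSeries.mk (conv (conv u v) w) = PowerSeries.mk (conv u (conv v w)) := by
    simp_rw [mk_conv, mul_assoc]
  funext n
  simpa using congrArg (PowerSeries.coeff n) h

theorem delta_conv (u : ℕ → ℝ) : conv delta u = u := by
  have h : PowerSeries.mk (conv delta u) = PowerSeries.mk u := by
    rw [mk_conv, mk_delta, one_mul]
  funext n
  simpa using congrArg (PowerSeries.coeff n) h

theorem conv_one_right (u : ℕ → ℝ) (n : ℕ) :
    conv u (negBinom 1) n = ∑ m ∈ range (n + 1), u m := by
  simp [conv, negBinom_one]

/-- An average of the ratios a_m / `negBinom α m`, which tend to 1; the weights sum to `negBinom 1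
n` = 1. -/
theorem tendsto_conv_a_negBinom {α : ℝ} (hα0 : 0 < α) (hα1 : α < 1) :
    Tendsto (conv (a α) (negBinom (1 - α))) atTop (𝓝 1) := by
  have hx : Tendsto (fun m => a α m / negBinom α m) atTop (𝓝 1) := by
    have hG : Real.Gamma α ≠ 0 := (Real.Gamma_pos_of_pos hα0).ne'
    have h := (tendsto_a_div_rpow hα0).div (tendsto_negBinom_div_rpow hα0) (one_div_ne_zero hG)
    rw [div_self (one_div_ne_zero hG)] at h
    refine h.congr' ?_
    filter_upwards [eventually_gt_atTop 0] with n hn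
    have hn' : (0 : ℝ) < n := by exact_mod_cast hn
    exact div_div_div_cancel_right₀ (Real.rpow_pos_of_pos hn' (α - 1)).ne' _ _
  have hβ : 0 < 1 - α := by linarith
  refine (tendsto_sum_mul_of_regular
    (w := fun n m => negBinom α m * negBinom (1 - α) (n - m)) ?_ ?_ ?_ hx).congr ?_
  · exact fun n m => (mul_pos (negBinom_pos hα0 m) (negBinom_pos hβ _)).le
  · intro n
    have := congrFun (conv_negBinom α (1 - α)) n
    rwa [add_sub_cancel, negBinom_one] at this
  · intro m
    simpa using ((tendsto_negBinom_zero hβ (by linarith)).comp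
      (tendsto_sub_atTop_nat m)).const_mul (negBinom α m)
  · intro n
    refine sum_congr rfl fun m _ => ?_
    have := (negBinom_pos hα0 m).ne'
    field_simp

/-- If `d * a = 1` with `d` nonnegative and bounded, the partial sums of `d` are asymptotic to the
coefficients of `(1 - z)^(α - 2)`. -/
theorem tendsto_sum_div_negBinom {α : ℝ} (hα0 : 0 < α) (hα1 : α < 1) {d : ℕ → ℝ}
    (hd : ∀ n, 0 ≤ d n) {B : ℝ} (hB : ∀ n, d n ≤ B) (h : conv d (a α) = negBinom 1) :
    Tendsto (fun n => (∑ m ∈ range (n + 1), d m) / negBinom (2 - α) n) atTop (𝓝 1) := by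
  set e := conv (a α) (negBinom (1 - α)) with he
  have hβ : 0 < 1 - α := by linarith
  have hγ : 0 < 2 - α := by linarith
  have hpos : ∀ n, 0 < e n := fun n =>
    sum_pos (fun m _ => mul_pos (a_pos hα0 m) (negBinom_pos hβ _)) ⟨0, by simp⟩
  have hde : conv e d = negBinom (2 - α) := by
    rw [conv_comm, he, ← conv_assoc, h, conv_negBinom]
    congr 1
    ring
  have hx : Tendsto (fun n => (e n)⁻¹) atTop (𝓝 1) := by
    simpa using (tendsto_conv_a_negBinom hα0 hα1).inv₀ one_ne_zero
  -- Averaging 1/e_m cancels e_m and leaves the partial sums of d. Rows sum to one by `hde`; columns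
  -- vanish because d is bounded and `negBinom (2 - α)` diverges.
  refine (tendsto_sum_mul_of_regular
    (w := fun n m => e m * d (n - m) / negBinom (2 - α) n) ?_ ?_ ?_ hx).congr ?_
  · exact fun n m => div_nonneg (mul_nonneg (hpos m).le (hd _)) (negBinom_pos hγ n).le
  · intro n
    rw [← sum_div, ← congrFun hde n]
    refine div_self (a := conv e d n) ?_
    rw [congrFun hde n]
    exact (negBinom_pos hγ n).ne'
  · intro m
    refine squeeze_zero (fun n => div_nonneg (mul_nonneg (hpos m).le (hd _)) (negBinom_pos hγ n).le)
      (fun n => ?_) ((tendsto_negBinom_atTop (β := 2 - α) (by linarith)).const_div_atTop (e m * B))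
    have := negBinom_pos hγ n
    have := (hpos m).le
    gcongr
    exact hB _
  · intro n
    rw [← sum_range_reflect d, sum_div]
    refine sum_congr rfl fun m hm => ?_
    have := (hpos m).ne'
    rw [Nat.add_sub_cancel]
    field_simp

/-! ### Monotone density -/

/-- Concavity: beyond N the graph lies below the line through the points at n and n+1, on either
side. -/
theorem le_add_sub_mul_of_antitone_diff {G : ℕ → ℝ} {N : ℕ}
    (hanti : ∀ n, N ≤ n → G (n + 2) - G (n + 1) ≤ G (n + 1) - G n) {n K : ℕ}
    (hn : N ≤ n) (hK : N ≤ K) : G K ≤ G n + ((K : ℝ) - n) * (G (n + 1) - G n) := by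
  have hf : ∀ i j, N ≤ i → i ≤ j → G (j + 1) - G j ≤ G (i + 1) - G i := by
    intro i j hi hij
    induction j, hij using Nat.le_induction with
    | base => rfl
    | succ j hj ih => exact (hanti j (hi.trans hj)).trans ih
  rcases le_total n K with hnK | hKn
  · induction K, hnK using Nat.le_induction with
    | base => simp
    | succ j hj ih =>
      have := ih (hn.trans hj)
      have := hf n j hn hj
      push_cast
      linarith
  · have key : ∀ j, K ≤ j → j ≤ n →
        G K ≤ G j + ((K : ℝ) - j) * (G (n + 1) - G n) := by
      intro j hj
      induction j, hj using Nat.le_induction with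
      | base => simp
      | succ j hj ih =>
        intro hjn
        have := ih (by lia)
        have := hf j n (hK.trans hj) (by lia)
        push_cast
        linarith
    exact key n hKn le_rfl

/-- Monotone density theorem for sequences. -/
theorem tendsto_sub_div_rpow_of_antitone {G : ℕ → ℝ} {C ρ : ℝ} {N : ℕ}
    (hanti : ∀ n, N ≤ n → G (n + 2) - G (n + 1) ≤ G (n + 1) - G n)
    (hG : Tendsto (fun n : ℕ => G n / (n : ℝ) ^ ρ) atTop (𝓝 C)) :
    Tendsto (fun n : ℕ => (G (n + 1) - G n) / (n : ℝ) ^ (ρ - 1)) atTop (𝓝 (C * ρ)) := by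
  have hslope : Tendsto (fun l : ℝ => C * (l ^ ρ - 1) / (l - 1)) (𝓝[≠] 1) (𝓝 (C * ρ)) := by
    have hd : HasDerivAt (fun x : ℝ => x ^ ρ) (ρ * 1 ^ (ρ - 1)) 1 :=
      Real.hasDerivAt_rpow_const (Or.inl one_ne_zero)
    have h := (hasDerivAt_iff_tendsto_slope.1 hd).const_mul C
    rw [Real.one_rpow, mul_one] at h
    refine h.congr fun l => ?_
    rw [slope_def_field, Real.one_rpow, mul_div_assoc]
  have hceil : ∀ l : ℝ, 0 < l →
      Tendsto (fun n : ℕ => (⌈l * n⌉₊ : ℝ) / n) atTop (𝓝 l) := fun l hl =>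
    (tendsto_nat_ceil_mul_div_atTop hl.le).comp tendsto_natCast_atTop_atTop
  have hK : ∀ l : ℝ, 0 < l → Tendsto (fun n : ℕ => ⌈l * n⌉₊) atTop atTop := fun l hl =>
    tendsto_nat_ceil_atTop.comp (tendsto_natCast_atTop_atTop.const_mul_atTop hl)
  have hden : ∀ l : ℝ, 0 < l →
      Tendsto (fun n : ℕ => (⌈l * n⌉₊ : ℝ) / n - 1) atTop (𝓝 (l - 1)) := fun l hl =>
    (hceil l hl).sub_const 1
  have hquot : ∀ l : ℝ, 0 < l → l ≠ 1 →
      Tendsto (fun n : ℕ => (G ⌈l * n⌉₊ / (n : ℝ) ^ ρ - G n / (n : ℝ) ^ ρ) /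
        ((⌈l * n⌉₊ : ℝ) / n - 1)) atTop (𝓝 (C * (l ^ ρ - 1) / (l - 1))) := by
    intro l hl hl1
    refine Tendsto.div ?_ (hden l hl) (sub_ne_zero.2 hl1)
    rw [mul_sub, mul_one]
    refine Tendsto.sub ?_ hG
    refine ((hG.comp (hK l hl)).mul ((hceil l hl).rpow_const (p := ρ) (Or.inl hl.ne'))).congr' ?_
    filter_upwards [eventually_gt_atTop 0, (hK l hl).eventually_gt_atTop 0] with n hn hKn
    have hn' : (0 : ℝ) < n := by exact_mod_cast hn
    have hKn' : (0 : ℝ) < ⌈l * n⌉₊ := by exact_mod_cast hKn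
    have h1 := Real.rpow_pos_of_pos hn' ρ
    have h2 := Real.rpow_pos_of_pos hKn' ρ
    simp only [Function.comp]
    rw [Real.div_rpow hKn'.le hn'.le]
    field_simp
  have hineq : ∀ l : ℝ, 0 < l → ∀ᶠ n : ℕ in atTop,
      G ⌈l * n⌉₊ / (n : ℝ) ^ ρ - G n / (n : ℝ) ^ ρ ≤
        ((⌈l * n⌉₊ : ℝ) / n - 1) * ((G (n + 1) - G n) / (n : ℝ) ^ (ρ - 1)) := by
    intro l hl
    filter_upwards [eventually_gt_atTop 0, eventually_ge_atTop N,
      (hK l hl).eventually_ge_atTop N] with n hn hnN hKN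
    have hn' : (0 : ℝ) < n := by exact_mod_cast hn
    have h1 := Real.rpow_pos_of_pos hn' ρ
    have h := le_add_sub_mul_of_antitone_diff hanti hnN hKN
    rw [← sub_div, Real.rpow_sub_one hn'.ne', div_le_iff₀ h1]
    have e : ((⌈l * n⌉₊ : ℝ) / n - 1) * ((G (n + 1) - G n) / ((n : ℝ) ^ ρ / n)) * (n : ℝ) ^ ρ =
        ((⌈l * n⌉₊ : ℝ) - n) * (G (n + 1) - G n) := by
      field_simp
    rw [e]
    linarith
  -- Dividing `hineq` by K/n - 1, with K = ⌈l n⌉, gives a lower bound for l > 1 and an upper bound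
  -- for l < 1; both tend to Cρ as l → 1.
  refine tendsto_order.2 ⟨fun x hx => ?_, fun x hx => ?_⟩
  · obtain ⟨l, hxl, hl⟩ := ((hslope.mono_left (nhdsGT_le_nhdsNE 1)).eventually_const_lt hx |>.and
      self_mem_nhdsWithin).exists
    have hl : 1 < l := hl
    have hl0 : 0 < l := by linarith
    filter_upwards [(hquot l hl0 hl.ne').eventually_const_lt hxl, hineq l hl0,
      (hden l hl0).eventually_const_lt (sub_pos.2 hl)] with n h1 h2 h3
    exact h1.trans_le ((div_le_iff₀' h3).2 h2)
  · obtain ⟨l, ⟨hxl, hl⟩, hl0⟩ := (((hslope.mono_left (nhdsLT_le_nhdsNE 1)).eventually_lt_const hx |>.and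
      self_mem_nhdsWithin).and
      (eventually_nhdsWithin_of_eventually_nhds (eventually_gt_nhds zero_lt_one))).exists
    have hl : l < 1 := hl
    filter_upwards [(hquot l hl0 hl.ne).eventually_lt_const hxl, hineq l hl0,
      (hden l hl0).eventually_lt_const (sub_neg.2 hl)] with n h1 h2 h3
    exact ((le_div_iff_of_neg' h3).2 h2).trans_lt h1

/-! ### Signs and monotonicity of the coefficients -/

theorem conv_convInv_a {α : ℝ} (hα : 0 < α) : conv (convInv (a α)) (a α) = delta := by
  rw [conv_comm]
  exact (conv_eq_delta_iff _ _ (a_zero_ne_zero α hα)).2 rfl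

theorem c_zero {α : ℝ} (hα : 0 < α) : c α 0 = Real.Gamma (1 + α) := by
  have h : convInv (a α) 0 * a α 0 = 1 := by
    simpa [conv, delta] using congrFun (conv_convInv_a hα) 0
  have hG := (Real.Gamma_pos_of_pos (by linarith : 0 < 1 + α)).ne'
  simp only [a, Nat.cast_zero, zero_add, Real.one_rpow, Real.zero_rpow hα.ne', sub_zero] at h
  rw [c, if_pos rfl]
  field_simp at h
  exact h

theorem c_succ (α : ℝ) (n : ℕ) : c α (n + 1) = -convInv (a α) (n + 1) := by
  simp [c]

/-- The moment argument starts at index 2, so index 1 is read off b_0 a_1 + b_1 a_0 = 0. -/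
theorem c_one_pos {α : ℝ} (hα : 0 < α) : 0 < c α 1 := by
  have h := congrFun (conv_convInv_a hα) 1
  have h0 : 0 < convInv (a α) 0 := by
    have := c_zero hα
    rw [c, if_pos rfl] at this
    rw [this]
    exact Real.Gamma_pos_of_pos (by linarith)
  simp only [conv, delta, sum_range_succ, range_zero, sum_empty, one_ne_zero, if_false,
    zero_add, Nat.sub_zero, Nat.sub_self] at h
  refine pos_of_mul_pos_left ?_ (a_pos hα 0).le
  rw [c_succ]
  have := mul_pos h0 (a_pos hα 1)
  linarith

theorem c_nonneg {α : ℝ} (hα0 : 0 < α) (hα1 : α < 1) (n : ℕ) : 0 ≤ c α n := by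
  match n with
  | 0 =>
    rw [c_zero hα0]
    exact (Real.Gamma_pos_of_pos (by linarith)).le
  | 1 => exact (c_one_pos hα0).le
  | n + 2 =>
    rw [c_succ, neg_nonneg]
    exact (isHausdorffMoment_a hα0 hα1).convInverse_nonpos (conv_convInv_a hα0) n

theorem c_succ_le {α : ℝ} (hα0 : 0 < α) (hα1 : α < 1) {n : ℕ} (hn : 2 ≤ n) :
    c α (n + 1) ≤ c α n := by
  obtain ⟨n, rfl⟩ := Nat.exists_eq_add_of_le' hn
  rw [c_succ, c_succ, neg_le_neg_iff]
  exact (isHausdorffMoment_a hα0 hα1).convInverse_le_succ (conv_convInv_a hα0) n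

theorem cInit_succ (α : ℝ) {n : ℕ} (hn : 1 ≤ n) : cInit α (n + 1) = cInit α n - c α n := by
  rw [cInit, cInit, sum_Ico_succ_top hn]
  ring

theorem cInit_one (α : ℝ) : cInit α 1 = c α 0 := by simp [cInit]

theorem cInit_succ_eq_sum (α : ℝ) (n : ℕ) :
    cInit α (n + 1) = ∑ m ∈ range (n + 1), convInv (a α) m := by
  induction n with
  | zero => simp [cInit_one, c]
  | succ n ih =>
    rw [cInit_succ α (Nat.le_add_left 1 n), ih, sum_range_succ _ (n + 1), c_succ, sub_neg_eq_add]

theorem conv_cInit_a {α : ℝ} (hα : 0 < α) :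
    conv (fun n => cInit α (n + 1)) (a α) = negBinom 1 := by
  have e : (fun n => cInit α (n + 1)) = conv (negBinom 1) (convInv (a α)) := by
    funext n
    rw [cInit_succ_eq_sum, conv_comm, conv_one_right]
  rw [e, conv_assoc, conv_convInv_a hα, conv_comm, delta_conv]

/-- Subtract the identities d * a = 1 at n and n+1: as `a` decreases, the terms before the last sum
to at most 1 at n+1. -/
theorem cInit_succ_nonneg {α : ℝ} (hα0 : 0 < α) (hα1 : α < 1) (n : ℕ) :
    0 ≤ cInit α (n + 1) := by
  induction n using Nat.strong_induction_on with
  | _ n ih =>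
    match n with
    | 0 =>
      rw [cInit_one]
      exact c_nonneg hα0 hα1 0
    | n + 1 =>
      have h1 := congrFun (conv_cInit_a hα0) (n + 1)
      have h0 := congrFun (conv_cInit_a hα0) n
      rw [conv, negBinom_one] at h0 h1
      rw [sum_range_succ, Nat.sub_self] at h1
      have hle : ∑ m ∈ range (n + 1), cInit α (m + 1) * a α (n + 1 - m) ≤
          ∑ m ∈ range (n + 1), cInit α (m + 1) * a α (n - m) :=
        sum_le_sum fun m hm => mul_le_mul_of_nonneg_left
          ((isHausdorffMoment_a hα0 hα1).antitone (by lia)) (ih m (mem_range.1 hm))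
      exact nonneg_of_mul_nonneg_left (b := a α 0) (by linarith) (a_pos hα0 0)

theorem cInit_succ_le {α : ℝ} (hα0 : 0 < α) (hα1 : α < 1) (n : ℕ) :
    cInit α (n + 2) ≤ cInit α (n + 1) := by
  rw [cInit_succ α (Nat.le_add_left 1 n)]
  exact sub_le_self _ (c_nonneg hα0 hα1 _)

theorem cInit_succ_le_c_zero {α : ℝ} (hα0 : 0 < α) (hα1 : α < 1) (n : ℕ) :
    cInit α (n + 1) ≤ c α 0 := by
  rw [← cInit_one]
  exact antitone_nat_of_succ_le (f := fun n => cInit α (n + 1)) (cInit_succ_le hα0 hα1)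
    (Nat.zero_le n)

/-! ### Asymptotics and the sum of the series -/

theorem tendsto_cInit_succ_div_rpow {α : ℝ} (hα0 : 0 < α) (hα1 : α < 1) :
    Tendsto (fun n : ℕ => cInit α (n + 1) / (n : ℝ) ^ (-α)) atTop
      (𝓝 (1 / Real.Gamma (1 - α))) := by
  have hβ : 0 < 1 - α := by linarith
  have hγ : 0 < 2 - α := by linarith
  have hS := (tendsto_sum_div_negBinom hα0 hα1 (cInit_succ_nonneg hα0 hα1)
    (cInit_succ_le_c_zero hα0 hα1) (conv_cInit_a hα0)).mul (tendsto_negBinom_div_rpow hγ)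
  -- The last summand is negligible; without it, the forward difference at n is exactly `cInit α (n
  -- + 1)`.
  have hd : Tendsto (fun n : ℕ => cInit α (n + 1) / (n : ℝ) ^ (1 - α)) atTop (𝓝 0) := by
    refine squeeze_zero (fun n => div_nonneg (cInit_succ_nonneg hα0 hα1 n) (by positivity))
      (fun n => div_le_div_of_nonneg_right (cInit_succ_le_c_zero hα0 hα1 n) (by positivity))
      (((tendsto_rpow_atTop hβ).comp tendsto_natCast_atTop_atTop).const_div_atTop (c α 0))
  have hG : Tendsto (fun n : ℕ => (∑ m ∈ range n, cInit α (m + 1)) / (n : ℝ) ^ (1 - α)) atTop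
      (𝓝 (1 / Real.Gamma (2 - α))) := by
    have h := hS.sub hd
    rw [one_mul, sub_zero] at h
    refine h.congr fun n => ?_
    have := (negBinom_pos hγ n).ne'
    rw [sum_range_succ, show 2 - α - 1 = 1 - α by ring, div_mul_div_cancel₀ this, ← sub_div,
      add_sub_cancel_right]
  have h := tendsto_sub_div_rpow_of_antitone (N := 0) (fun n _ => by
    simpa only [sum_range_succ_sub_sum] using cInit_succ_le hα0 hα1 n) hG
  simp only [sum_range_succ_sub_sum] at h
  have hG1 := (Real.Gamma_pos_of_pos hβ).ne'
  rw [show 1 - α - 1 = -α by ring, show 2 - α = (1 - α) + 1 by ring,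
    Real.Gamma_add_one hβ.ne'] at h
  convert h using 2
  field_simp

theorem tendsto_cInit_div_rpow {α : ℝ} (hα0 : 0 < α) (hα1 : α < 1) :
    Tendsto (fun n : ℕ => cInit α n / (n : ℝ) ^ (-α)) atTop (𝓝 (1 / Real.Gamma (1 - α))) := by
  rw [← tendsto_add_atTop_iff_nat 1]
  have hr : Tendsto (fun n : ℕ => ((n : ℝ) / (n + 1)) ^ (-α)) atTop (𝓝 1) := by
    simpa using (tendsto_natCast_div_add_atTop (1 : ℝ)).rpow_const (p := -α)
      (Or.inl one_ne_zero)
  have h := (tendsto_cInit_succ_div_rpow hα0 hα1).mul hr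
  rw [mul_one] at h
  refine h.congr' ?_
  filter_upwards [eventually_gt_atTop 0] with n hn
  have hn' : (0 : ℝ) < n := by exact_mod_cast hn
  have := (Real.rpow_pos_of_pos hn' (-α)).ne'
  rw [Real.div_rpow hn'.le (by positivity), div_mul_div_cancel₀ this]
  push_cast
  rfl

theorem tendsto_cInit_zero {α : ℝ} (hα0 : 0 < α) (hα1 : α < 1) :
    Tendsto (cInit α) atTop (𝓝 0) := by
  have h := (tendsto_cInit_div_rpow hα0 hα1).mul
    ((tendsto_rpow_neg_atTop hα0).comp tendsto_natCast_atTop_atTop)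
  rw [mul_zero] at h
  refine h.congr' ?_
  filter_upwards [eventually_gt_atTop 0] with n hn
  have hn' : (0 : ℝ) < n := by exact_mod_cast hn
  exact div_mul_cancel₀ _ (Real.rpow_pos_of_pos hn' _).ne'

theorem tendsto_c_div_rpow {α : ℝ} (hα0 : 0 < α) (hα1 : α < 1) :
    Tendsto (fun n : ℕ => c α n / (n : ℝ) ^ (-1 - α)) atTop
      (𝓝 (α / Real.Gamma (1 - α))) := by
  have hdiff : ∀ n, 1 ≤ n → -cInit α (n + 1) - -cInit α n = c α n := fun n hn => by
    rw [cInit_succ α hn]; ring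
  have hG := (tendsto_cInit_div_rpow hα0 hα1).neg
  simp_rw [← neg_div] at hG
  -- The sign makes the increments equal to c_n, which are known to decrease only from n = 2.
  have h := tendsto_sub_div_rpow_of_antitone (G := fun n => -cInit α n) (N := 2) (fun n hn => by
    rw [hdiff n (by lia), hdiff (n + 1) (by lia)]
    exact c_succ_le hα0 hα1 hn) hG
  rw [show -1 / Real.Gamma (1 - α) * -α = α / Real.Gamma (1 - α) by ring,
    show -α - 1 = -1 - α by ring] at h
  refine h.congr' ?_
  filter_upwards [eventually_ge_atTop 1] with n hn
  rw [hdiff n hn]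

/-- The equivalent makes c_j positive for some large j, and monotonicity carries this back to index
2. -/
theorem c_pos {α : ℝ} (hα0 : 0 < α) (hα1 : α < 1) (n : ℕ) : 0 < c α n := by
  match n with
  | 0 =>
    rw [c_zero hα0]
    exact Real.Gamma_pos_of_pos (by linarith)
  | 1 => exact c_one_pos hα0
  | n + 2 =>
    have hlim : 0 < α / Real.Gamma (1 - α) := div_pos hα0 (Real.Gamma_pos_of_pos (by linarith))
    obtain ⟨j, hj, hnj⟩ := (((tendsto_c_div_rpow hα0 hα1).eventually_const_lt hlim).and
      (eventually_ge_atTop (n + 2))).exists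
    have hcj : 0 < c α j := pos_of_mul_pos_left (b := ((j : ℝ) ^ (-1 - α))⁻¹)
      (by rwa [← div_eq_mul_inv]) (by positivity)
    refine hcj.trans_le ?_
    clear hj hcj
    induction j, hnj using Nat.le_induction with
    | base => rfl
    | succ j hj ih => exact (c_succ_le hα0 hα1 (by lia)).trans ih

/-- The sum telescopes and `cInit` tends to zero. -/
theorem hasSum_c_add {α : ℝ} (hα0 : 0 < α) (hα1 : α < 1) {n : ℕ} (hn : 1 ≤ n) :
    HasSum (fun i => c α (n + i)) (cInit α n) := by
  rw [hasSum_iff_tendsto_nat_of_nonneg fun i => c_nonneg hα0 hα1 (n + i)]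
  have hsum : ∀ N, ∑ i ∈ range N, c α (n + i) = cInit α n - cInit α (N + n) := by
    intro N
    induction N with
    | zero => simp
    | succ N ih =>
      rw [sum_range_succ, ih, show N + 1 + n = (N + n) + 1 by ring,
        cInit_succ α (show 1 ≤ N + n by lia), add_comm n N]
      ring
  simp_rw [hsum]
  simpa using ((tendsto_add_atTop_iff_nat n).2 (tendsto_cInit_zero hα0 hα1)).const_sub (cInit α n)

end CaputoDeconv

theorem proposition3p1 (α : ℝ) (hα0 : 0 < α) (hα1 : α < 1) :
    (∀ i : ℕ, 0 < CaputoDeconv.c α i) ∧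
    CaputoDeconv.c α 0 = Real.Gamma (1 + α) ∧
    HasSum (fun i : ℕ => CaputoDeconv.c α (i + 1)) (Real.Gamma (1 + α)) ∧
    (∀ n : ℕ, 1 ≤ n →
      HasSum (fun i : ℕ => CaputoDeconv.c α (n + i)) (CaputoDeconv.cInit α n) ∧
      0 < CaputoDeconv.cInit α n ∧
      CaputoDeconv.c α 0 =
        ∑ i ∈ Finset.Ico 1 n, CaputoDeconv.c α i + CaputoDeconv.cInit α n) ∧
    Asymptotics.IsEquivalent Filter.atTop
      (fun j : ℕ => CaputoDeconv.c α j)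
      (fun j : ℕ => -1 / Real.Gamma (-α) * (j : ℝ) ^ (-1 - α)) ∧
    Asymptotics.IsEquivalent Filter.atTop
      (fun n : ℕ => CaputoDeconv.cInit α n)
      (fun n : ℕ => (n : ℝ) ^ (-α) / Real.Gamma (1 - α)) := by
  have hG : 0 < Real.Gamma (1 - α) := Real.Gamma_pos_of_pos (by linarith)
  refine ⟨CaputoDeconv.c_pos hα0 hα1, CaputoDeconv.c_zero hα0, ?_, fun n hn => ⟨?_, ?_, ?_⟩, ?_, ?_⟩
  · have h := CaputoDeconv.hasSum_c_add hα0 hα1 le_rfl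
    rw [CaputoDeconv.cInit_one, CaputoDeconv.c_zero hα0] at h
    simpa only [add_comm 1] using h
  · exact CaputoDeconv.hasSum_c_add hα0 hα1 hn
  · have h := CaputoDeconv.hasSum_c_add hα0 hα1 hn
    rw [← h.tsum_eq]
    exact h.summable.tsum_pos (fun i => (CaputoDeconv.c_pos hα0 hα1 _).le) 0
      (CaputoDeconv.c_pos hα0 hα1 _)
  · rw [CaputoDeconv.cInit]
    ring
  · have hGamma : -1 / Real.Gamma (-α) = α / Real.Gamma (1 - α) := by
      -- Γ(1-α) = -α Γ(-α) turns the stated constant into α/Γ(1-α).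
      have e := Real.Gamma_add_one (s := -α) (by linarith)
      rw [neg_add_eq_sub] at e
      have hne : Real.Gamma (-α) ≠ 0 := fun h0 => hG.ne' (by rw [e, h0, mul_zero])
      rw [e]
      field_simp
    rw [hGamma]
    have hC := (div_pos hα0 hG).ne'
    have h := (CaputoDeconv.tendsto_c_div_rpow hα0 hα1).div_const (α / Real.Gamma (1 - α))
    rw [div_self hC] at h
    refine Asymptotics.isEquivalent_of_tendsto_one (h.congr fun n => ?_)
    rw [div_div, mul_comm]
    rfl
  · have h := (CaputoDeconv.tendsto_cInit_div_rpow hα0 hα1).mul_const (Real.Gamma (1 - α))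
    rw [one_div, inv_mul_cancel₀ hG.ne'] at h
    refine Asymptotics.isEquivalent_of_tendsto_one (h.congr fun n => ?_)
    rw [Pi.div_apply, div_div_eq_mul_div, div_mul_eq_mul_div]
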